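/- There is a constant $c>0$ such that for all sufficiently large $n$, the randomized query complexity of finding a (possibly mixed) Nash equilibrium in $n$-player $30$-action potential games is at least $2^{cn}$, i.e. it is $2^{\Omega(n)}$. Here an $n$-player $30$-action game is given by utilities $u_i : A^n \to \mathbb{R}$, $i=1,\dots,n$, with $|A|=30$. It is a potential game if there is a function $\varphi : A^n\to\mathbb{R}$ such that $u_i(x_i,z_{-i})-u_i(y_i,z_{-i})=\varphi(x_i,z_{-i})-\varphi(y_i,z_{-i})$ for every player $i$, all actions $x_i,y_i\in A$ and all actions $z_{-i}$ of the other players. A mixed Nash equilibrium is a profile $(\sigma_1,\dots,\sigma_n)$ of probability distributions on $A$ such that, when the players randomize independently, no player can increase her expected utility by switching to another distribution. A query names a pure action profile $a\in A^n$ and is answered by all the utilities $(u_1(a),\dots,u_n(a))$. The randomized query complexity is the least $k$ for which there is a randomized adaptive algorithm that, on every $n$-player $30$-action potential game, makes at most $k$ queries and outputs a mixed Nash equilibrium with probability at least $2/3$. -/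

import Mathlib

open MeasureTheory Filter
open scoped ENNReal

/-- A finite game with `n` players, each with the action set `Fin m`: `u i a` is the utility of
player `i` at the pure action profile `a`. -/
abbrev Game (n m : ℕ) : Type := Fin n → (Fin n → Fin m) → ℝ

/-- An (exact) potential game: there is a function `φ` on action profiles such that every unilateral
change of action changes the utility of the deviating player by exactly the change of `φ`. -/
def IsPotentialGame {n m : ℕ} (u : Game n m) : Prop :=
  ∃ φ : (Fin n → Fin m) → ℝ, ∀ (i : Fin n) (z : Fin n → Fin m) (x y : Fin m),
    u i (Function.update z i x) - u i (Function.update z i y) =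
      φ (Function.update z i x) - φ (Function.update z i y)

/-- Expected utility of player `i` when the players randomize independently, player `j` playing
action `x` with probability `σ j x`. -/
noncomputable def expectedUtility {n m : ℕ} (u : Game n m) (i : Fin n) (σ : Fin n → Fin m → ℝ) :
    ℝ :=
  ∑ a : Fin n → Fin m, (∏ j, σ j (a j)) * u i a

/-- A (possibly mixed) Nash equilibrium: every `σ i` is a probability distribution on the actions,
and no player can gain by switching to another distribution. -/
def IsNashEquilibrium {n m : ℕ} (u : Game n m) (σ : Fin n → Fin m → ℝ) : Prop :=
  (∀ i, σ i ∈ stdSimplex ℝ (Fin m)) ∧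
    ∀ i, ∀ τ ∈ stdSimplex ℝ (Fin m),
      expectedUtility u i (Function.update σ i τ) ≤ expectedUtility u i σ

/-- A deterministic adaptive query algorithm (decision tree) for `n`-player `m`-action games. It
either stops with an output, or queries a pure action profile `a`; the answer is the vector of the
utilities of all players at `a`, and the algorithm continues depending on this answer. -/
inductive QueryTree (n m : ℕ) : Type
  | output (σ : Fin n → Fin m → ℝ) : QueryTree n m
  | query (a : Fin n → Fin m) (next : (Fin n → ℝ) → QueryTree n m) : QueryTree n m

/-- The output of a query algorithm on the game `u`. -/
def QueryTree.result {n m : ℕ} (u : Game n m) : QueryTree n m → (Fin n → Fin m → ℝ)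
  | .output σ => σ
  | .query a next => (next fun i => u i a).result u

/-- The number of queries that a query algorithm makes on the game `u`. -/
def QueryTree.numQueries {n m : ℕ} (u : Game n m) : QueryTree n m → ℕ
  | .output _ => 0
  | .query a next => (next fun i => u i a).numQueries u + 1

/-- There is a randomized query algorithm (a random decision tree) that, on every `n`-player
`m`-action potential game, makes at most `k` queries for every outcome of its coins and outputs a
Nash equilibrium with probability at least `2/3`. -/
def NashSolvableWithin (n m k : ℕ) : Prop :=
  ∃ (Ω : Type) (_ : MeasurableSpace Ω) (P : Measure Ω) (_ : IsProbabilityMeasure P)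
    (T : Ω → QueryTree n m), ∀ u : Game n m, IsPotentialGame u →
      (∀ ω, (T ω).numQueries u ≤ k) ∧
      MeasurableSet {ω | IsNashEquilibrium u ((T ω).result u)} ∧
      2 / 3 ≤ P {ω | IsNashEquilibrium u ((T ω).result u)}

/-- The (bounded-error randomized) query complexity of finding a Nash equilibrium in `n`-player
`m`-action potential games: the least worst-case number of queries. -/
noncomputable def nashQueryComplexity (n m : ℕ) : ℕ∞ :=
  ⨅ (k : ℕ) (_ : NashSolvableWithin n m k), (k : ℕ∞)

/-! Hide the end of a long path. All players share one potential: a charge of 1 per nonzero action,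
plus geometrically growing bonuses along a path that starts at the profile 0 and changes one
coordinate at a time. The charges rule out equilibria that miss the path; the growth makes stopping
before its end unprofitable. So in every equilibrium each player puts mass at least 1/3 on the final
coordinate (`IsNashEquilibrium.one_third_le`), and an output is compatible with at most `3 ^ n`
endpoints.

The path joins `2 ^ n` independent uniform nodes. Given the nodes seen so far, each later path point
is uniform on `30 ^ n` profiles, so a query rarely lands ahead of the current segment. Otherwise its
answer is determined by one further node. With fewer than `2 ^ n` queries the last node stays
unseen, and a union bound over bad queries and lucky outputs (`card_solves_le`) leaves success on at
most half of the paths. Averaging over paths contradicts success probability 2/3. -/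

/-- The expected bonus of player `i` for the action `b` when the profile `x s` carries the bonus
`B s` and the other players follow `σ`. -/
noncomputable def bonus {n m : ℕ} (T : ℕ) (B : ℕ → ℝ) (x : ℕ → Fin n → Fin m)
    (σ : Fin n → Fin m → ℝ) (i : Fin n) (b : Fin m) : ℝ :=
  ∑ s ∈ Finset.range (T + 1),
    if x s i = b then B s * ∏ j ∈ Finset.univ.erase i, σ j (x s j) else 0

/-- The potential with bonus `B s` at the profile `x s`, and cost `1` for every player that does not
play the action `0`. -/
noncomputable def pathPotential {n m : ℕ} [NeZero m] (T : ℕ) (B : ℕ → ℝ) (x : ℕ → Fin n → Fin m)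
    (a : Fin n → Fin m) : ℝ :=
  (∑ s ∈ Finset.range (T + 1), if a = x s then B s else 0) - ∑ j, if a j = 0 then 0 else 1

/-! ### Equilibria of the path potential. -/

section Equilibrium

variable {n m : ℕ}

theorem sum_prod_mul_coord (σ : Fin n → Fin m → ℝ) (hσ : ∀ i, ∑ b, σ i b = 1) (i : Fin n)
    (f : Fin m → ℝ) :
    ∑ a : Fin n → Fin m, (∏ j, σ j (a j)) * f (a i) = ∑ b, σ i b * f b := by
  have h (a : Fin n → Fin m) : (∏ j, σ j (a j)) * f (a i) =
      ∏ j, σ j (a j) * (if j = i then f (a j) else 1) := by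
    rw [Finset.prod_mul_distrib]
    simp
  simp_rw [h]
  rw [← Fintype.prod_sum (fun j b => σ j b * (if j = i then f b else 1)),
    Finset.prod_eq_single i]
  · simp
  · intro j _ hj
    simp [hj, hσ]
  · simp

theorem expectedUtility_pathPotential [NeZero m] (T : ℕ) (B : ℕ → ℝ) (x : ℕ → Fin n → Fin m)
    (σ : Fin n → Fin m → ℝ) (hσ : ∀ i, ∑ b, σ i b = 1) (i : Fin n) :
    expectedUtility (fun _ => pathPotential T B x) i σ =
      (∑ s ∈ Finset.range (T + 1), B s * ∏ j, σ j (x s j)) -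
        ∑ j, ∑ b, σ j b * if b = 0 then 0 else 1 := by
  unfold expectedUtility pathPotential
  simp_rw [mul_sub, Finset.sum_sub_distrib, Finset.mul_sum]
  congr 1
  · rw [Finset.sum_comm]
    refine Finset.sum_congr rfl fun s _ => ?_
    simp [mul_ite, mul_comm]
  · rw [Finset.sum_comm]
    exact Finset.sum_congr rfl fun j _ => sum_prod_mul_coord σ hσ j fun b => if b = 0 then 0 else 1

/-- The total is the same for every player, which lets the best-response conditions of different
players be compared. -/
theorem sum_mul_bonus (T : ℕ) (B : ℕ → ℝ) (x : ℕ → Fin n → Fin m)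
    (σ : Fin n → Fin m → ℝ) (i : Fin n) :
    ∑ b, σ i b * bonus T B x σ i b =
      ∑ s ∈ Finset.range (T + 1), B s * ∏ j, σ j (x s j) := by
  unfold bonus
  simp_rw [Finset.mul_sum]
  rw [Finset.sum_comm]
  refine Finset.sum_congr rfl fun s _ => ?_
  simp only [mul_ite, mul_zero, Finset.sum_ite_eq, Finset.mem_univ, if_true]
  rw [← Finset.mul_prod_erase Finset.univ (fun j => σ j (x s j)) (Finset.mem_univ i)]
  ring

theorem bonus_update (T : ℕ) (B : ℕ → ℝ) (x : ℕ → Fin n → Fin m)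
    (σ : Fin n → Fin m → ℝ) (i : Fin n) (τ : Fin m → ℝ) :
    bonus T B x (Function.update σ i τ) i = bonus T B x σ i := by
  funext b
  unfold bonus
  refine Finset.sum_congr rfl fun s _ => ?_
  congr 2
  refine Finset.prod_congr rfl fun j hj => ?_
  rw [Function.update_of_ne (Finset.ne_of_mem_erase hj)]

theorem expectedUtility_update [NeZero m] (T : ℕ) (B : ℕ → ℝ) (x : ℕ → Fin n → Fin m)
    (σ : Fin n → Fin m → ℝ) (hσ : ∀ i, ∑ b, σ i b = 1) (i : Fin n) (τ : Fin m → ℝ)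
    (hτ : ∑ b, τ b = 1) :
    expectedUtility (fun _ => pathPotential T B x) i (Function.update σ i τ) =
      (∑ b, τ b * (bonus T B x σ i b - if b = 0 then 0 else 1)) -
        ∑ j ∈ Finset.univ.erase i, ∑ b, σ j b * if b = 0 then 0 else 1 := by
  have h1 : ∀ j, ∑ b, Function.update σ i τ j b = 1 := by
    intro j
    rcases eq_or_ne j i with rfl | hj
    · simpa using hτ
    · simpa [hj] using hσ j
  rw [expectedUtility_pathPotential T B x _ h1, ← sum_mul_bonus T B x _ i, bonus_update,
    ← Finset.add_sum_erase Finset.univ _ (Finset.mem_univ i)]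
  have h2 : ∑ j ∈ Finset.univ.erase i, ∑ b, Function.update σ i τ j b * (if b = 0 then 0 else 1) =
      ∑ j ∈ Finset.univ.erase i, ∑ b, σ j b * if b = 0 then (0 : ℝ) else 1 := by
    refine Finset.sum_congr rfl fun j hj => ?_
    rw [Function.update_of_ne (Finset.ne_of_mem_erase hj)]
  rw [h2]
  simp only [Function.update_self, mul_sub, Finset.sum_sub_distrib]
  ring

/-- In an equilibrium every action that is played is a best response. -/
theorem IsNashEquilibrium.bonus_le [NeZero m] {T : ℕ} {B : ℕ → ℝ} {x : ℕ → Fin n → Fin m}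
    {σ : Fin n → Fin m → ℝ} (h : IsNashEquilibrium (fun _ => pathPotential T B x) σ)
    (i : Fin n) {a : Fin m} (ha : 0 < σ i a) (b : Fin m) :
    bonus T B x σ i b - (if b = 0 then 0 else 1) ≤
      bonus T B x σ i a - (if a = 0 then 0 else 1) := by
  have hσ : ∀ i, ∑ b, σ i b = 1 := fun i => (h.1 i).2
  set U : Fin m → ℝ := fun b => bonus T B x σ i b - (if b = 0 then 0 else 1) with hU
  have key : ∀ b, U b ≤ ∑ c, σ i c * U c := by
    intro b
    have h1 := h.2 i (Pi.single b 1) (single_mem_stdSimplex ℝ b)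
    have h2 := expectedUtility_update T B x σ hσ i (σ i) (hσ i)
    rw [Function.update_eq_self] at h2
    rw [expectedUtility_update T B x σ hσ i _ (by simp), h2] at h1
    have h3 : ∑ c, (Pi.single b 1 : Fin m → ℝ) c * U c = U b := by
      simp [Pi.single_apply]
    have h4 := (sub_le_sub_iff_right _).1 h1
    rw [← h3]
    exact h4
  change U b ≤ U a
  by_contra! hlt
  have h5 : ∑ c, σ i c * U c < ∑ c, σ i c * ∑ d, σ i d * U d := by
    refine Finset.sum_lt_sum (fun c _ => mul_le_mul_of_nonneg_left (key c) ((h.1 i).1 c))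
      ⟨a, Finset.mem_univ a, mul_lt_mul_of_pos_left (hlt.trans_le (key b)) ha⟩
  rw [← Finset.sum_mul, hσ i, one_mul] at h5
  exact lt_irrefl _ h5

/-- If the bonuses grow geometrically along a path from the profile `0`, every equilibrium puts
a substantial probability on each coordinate of the end of the path. -/
theorem IsNashEquilibrium.one_third_le [NeZero m] {T : ℕ} (hT : 0 < T) {G : ℝ}
    (hG : 300 * ((T : ℝ) + 1) ≤ G) (hGn : (2 : ℝ) ^ n ≤ G)
    {x : ℕ → Fin n → Fin m} (hx0 : x 0 = 0)
    (hx : ∀ s < T, ∃ i, ∀ j, j ≠ i → x (s + 1) j = x s j)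
    {σ : Fin n → Fin m → ℝ}
    (h : IsNashEquilibrium (fun _ => pathPotential T (fun s => G ^ (s + 1)) x) σ) (i : Fin n) :
    1 / 3 ≤ σ i (x T i) := by
  have hσ : ∀ i, ∑ b, σ i b = 1 := fun i => (h.1 i).2
  have hσ0 : ∀ i b, 0 ≤ σ i b := fun i => (h.1 i).1
  have hT1 : (1 : ℝ) ≤ T := by exact_mod_cast hT
  have hG1 : 300 ≤ G := by nlinarith
  have hG0 : 0 < G := by linarith
  set B : ℕ → ℝ := fun s => G ^ (s + 1) with hB
  have hB0 : ∀ s, 0 ≤ B s := fun s => by positivity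
  set W : ℝ := ∑ s ∈ Finset.range (T + 1), B s * ∏ j, σ j (x s j) with hW
  have hP0 : ∀ s, 0 ≤ ∏ j, σ j (x s j) := fun s => Finset.prod_nonneg fun j _ => hσ0 _ _
  have hPe0 : ∀ i s, 0 ≤ ∏ j ∈ Finset.univ.erase i, σ j (x s j) :=
    fun i s => Finset.prod_nonneg fun j _ => hσ0 _ _
  have hW0 : 0 ≤ W := Finset.sum_nonneg fun s _ => mul_nonneg (hB0 s) (hP0 s)
  have hPs : ∀ i s, ∏ j, σ j (x s j) =
      σ i (x s i) * ∏ j ∈ Finset.univ.erase i, σ j (x s j) := fun i s =>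
    (Finset.mul_prod_erase Finset.univ (fun j => σ j (x s j)) (Finset.mem_univ i)).symm
  have hb0 : ∀ i b, 0 ≤ bonus T B x σ i b := fun i b => Finset.sum_nonneg fun s _ => by
    split_ifs
    · exact mul_nonneg (hB0 s) (hPe0 i s)
    · exact le_rfl
  have hWb : ∀ i, ∑ b, σ i b * bonus T B x σ i b = W := fun i => sum_mul_bonus T B x σ i
  have hble : ∀ i, ∀ s < T + 1,
      B s * ∏ j ∈ Finset.univ.erase i, σ j (x s j) ≤ bonus T B x σ i (x s i) := by
    intro i s hs
    have := Finset.single_le_sum (f := fun r => if x r i = x s i then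
        B r * ∏ j ∈ Finset.univ.erase i, σ j (x r j) else 0) (fun r _ => by
      split_ifs
      · exact mul_nonneg (hB0 r) (hPe0 i r)
      · exact le_rfl) (Finset.mem_range.2 hs)
    simpa [bonus] using this
  have hcost : ∀ b : Fin m, (0 : ℝ) ≤ (if b = 0 then 0 else 1) ∧
      (if b = 0 then 0 else 1) ≤ (1 : ℝ) := fun b => by split_ifs <;> norm_num
  -- The player who moves at step `s` could switch to the next point, whose bonus is `G` times
  -- larger; if the current action is played, its bonus must match this up to the charge 1.
  have hstep : ∀ s < T, G * (B s * ∏ j, σ j (x s j)) ≤ W + 1 := by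
    intro s hs
    obtain ⟨i, hi⟩ := hx s hs
    rcases (hσ0 i (x s i)).eq_or_lt with h0 | hpos
    · rw [hPs i, ← h0]
      simp
      linarith
    have h1 := h.bonus_le i hpos (x (s + 1) i)
    have h2 := hble i (s + 1) (by omega)
    have h3 : ∏ j ∈ Finset.univ.erase i, σ j (x (s + 1) j) =
        ∏ j ∈ Finset.univ.erase i, σ j (x s j) :=
      Finset.prod_congr rfl fun j hj => by rw [hi j (Finset.ne_of_mem_erase hj)]
    have h4 : B (s + 1) = G * B s := by simp only [hB]; ring
    rw [h3, h4] at h2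
    have h5 : σ i (x s i) * bonus T B x σ i (x s i) ≤ W := by
      rw [← hWb i]
      exact Finset.single_le_sum (f := fun b => σ i b * bonus T B x σ i b)
        (fun b _ => mul_nonneg (hσ0 i b) (hb0 i b)) (Finset.mem_univ _)
    have h6 : σ i (x s i) ≤ 1 := by
      rw [← hσ i]
      exact Finset.single_le_sum (fun b _ => hσ0 i b) (Finset.mem_univ _)
    have h7 : G * B s * ∏ j ∈ Finset.univ.erase i, σ j (x s j) ≤
        bonus T B x σ i (x s i) + 1 := by
      linarith [(hcost (x s i)).1, (hcost (x (s + 1) i)).2]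
    have h8 := mul_le_mul_of_nonneg_left h7 hpos.le
    rw [hPs i]
    nlinarith
  -- If all players favour action 0, the start of the path already pays too much for `hstep`.
  -- Otherwise someone pays an expected charge of at least 1/2, which bonuses must cover.
  have hWhalf : 1 / 2 ≤ W := by
    by_contra! hlt
    have h1 := hstep 0 hT
    have h2 : ∃ i, σ i 0 ≤ 1 / 2 := by
      by_contra! hall
      have h3 : (1 / 2 : ℝ) ^ n ≤ ∏ j, σ j (x 0 j) := by
        rw [hx0]
        calc (1 / 2 : ℝ) ^ n = ∏ _j : Fin n, (1 / 2 : ℝ) := by simp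
          _ ≤ ∏ j, σ j ((0 : Fin n → Fin m) j) :=
            Finset.prod_le_prod (fun _ _ => by norm_num) fun j _ => (hall j).le
      have h4 : B 0 = G := by simp [hB]
      rw [h4] at h1
      have h5 : 1 ≤ G * ∏ j, σ j (x 0 j) := by
        calc (1 : ℝ) = 2 ^ n * (1 / 2) ^ n := by rw [← mul_pow]; norm_num
          _ ≤ _ := mul_le_mul hGn h3 (by positivity) hG0.le
      nlinarith
    obtain ⟨i, hi⟩ := h2
    have h3 : ∀ b, σ i b * (if b = 0 then 0 else 1) ≤ σ i b * bonus T B x σ i b := by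
      intro b
      rcases (hσ0 i b).eq_or_lt with h0 | hpos
      · simp [← h0]
      · have h4 := h.bonus_le i hpos 0
        refine mul_le_mul_of_nonneg_left ?_ hpos.le
        have h5 := hb0 i 0
        simp only [if_true] at h4
        linarith
    have h4 := Finset.sum_le_sum fun b (_ : b ∈ Finset.univ) => h3 b
    rw [hWb i] at h4
    have h5 : ∑ b, σ i b * (if b = 0 then 0 else 1) = 1 - σ i 0 := by
      have h6 : ∀ b, σ i b * (if b = 0 then 0 else 1) = σ i b - if b = 0 then σ i b else 0 :=
        fun b => by split_ifs <;> simp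
      simp [h6, hσ i]
    linarith
  set S : ℝ := ∑ s ∈ Finset.range T, B s * ∏ j, σ j (x s j) with hS
  have hSW : S ≤ W / 100 := by
    have h1 : G * S ≤ T * (W + 1) := by
      rw [hS, Finset.mul_sum]
      calc _ ≤ ∑ s ∈ Finset.range T, (W + 1) :=
            Finset.sum_le_sum fun s hs => hstep s (Finset.mem_range.1 hs)
        _ = _ := by simp [mul_add]
    -- `W ≥ 1/2` gives `W + 1 ≤ 3 * W`; with the target factor 1/100 this accounts for the 300.
    have h2 : (T : ℝ) * (W + 1) ≤ G * (W / 100) := by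
      have : (T : ℝ) * (W + 1) ≤ T * (3 * W) := by gcongr; linarith
      nlinarith
    exact le_of_mul_le_mul_left (h1.trans h2) hG0
  have hWS : W = S + B T * ∏ j, σ j (x T j) := Finset.sum_range_succ _ _
  by_contra! hlt
  set q := σ i (x T i) with hq
  set Z := B T * ∏ j ∈ Finset.univ.erase i, σ j (x T j) with hZ
  have hqZ : B T * ∏ j, σ j (x T j) = q * Z := by rw [hPs i]; ring
  have hZ0 : 0 ≤ Z := mul_nonneg (hB0 T) (hPe0 i T)
  have hZb : Z ≤ bonus T B x σ i (x T i) := hble i T (by omega)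
  -- `q * Z = W - S ≥ 0.99 * W`, and `q < 1/3`.
  have hZW : 2.97 * W ≤ Z := by nlinarith
  have hlow : ∀ a, σ i a * (Z - 1) ≤ σ i a * bonus T B x σ i a := by
    intro a
    rcases (hσ0 i a).eq_or_lt with h0 | hpos
    · simp [← h0]
    · refine mul_le_mul_of_nonneg_left ?_ hpos.le
      have := h.bonus_le i hpos (x T i)
      linarith [(hcost a).1, (hcost (x T i)).2]
  have hsumlow := Finset.sum_le_sum fun a (_ : a ∈ Finset.univ.erase (x T i)) => hlow a
  rw [← Finset.sum_mul] at hsumlow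
  have hq1 : ∑ a ∈ Finset.univ.erase (x T i), σ i a = 1 - q := by
    rw [eq_sub_iff_add_eq, add_comm, Finset.add_sum_erase _ _ (Finset.mem_univ _), hσ i]
  have hrest : ∑ a ∈ Finset.univ.erase (x T i), σ i a * bonus T B x σ i a ≤ S := by
    have h1 := Finset.add_sum_erase Finset.univ (fun a => σ i a * bonus T B x σ i a)
      (Finset.mem_univ (x T i))
    rw [hWb i] at h1
    have h2 := mul_le_mul_of_nonneg_left hZb (hσ0 i (x T i))
    linarith
  rw [hq1] at hsumlow
  -- Now `(1 - q) * (Z - 1) ≤ S ≤ W / 100`, impossible for `q < 1/3`, `Z ≥ 2.97 * W` and `W ≥ 1/2`.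
  nlinarith

end Equilibrium

/-! ### Counting by translation. -/

section Counting

/-- If `f` is equivariant and `C` invariant under a family of permutations of `V`, then `f v ∈ C v`
for a proportion of at most `K / |X|` of all `v`, where `K` bounds the size of `C v`. -/
theorem card_mul_card_filter_mem_le {V X : Type*} [Fintype V] [Fintype X] [DecidableEq X]
    [AddCommGroup X] (shift : X → V ≃ V) (f : V → X) (hf : ∀ y v, f (shift y v) = f v + y)
    (C : V → Finset X) (hC : ∀ y v, C (shift y v) = C v) {K : ℕ} (hK : ∀ v, (C v).card ≤ K) :
    Fintype.card X * (Finset.univ.filter fun v => f v ∈ C v).card ≤ K * Fintype.card V := by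
  have h1 (y : X) : (Finset.univ.filter fun v => f v ∈ C v).card =
      ∑ v : V, if f v + y ∈ C v then 1 else 0 := by
    rw [Finset.card_filter, ← Equiv.sum_comp (shift y)]
    simp only [hf, hC]
  calc Fintype.card X * (Finset.univ.filter fun v => f v ∈ C v).card
      = ∑ _y : X, (Finset.univ.filter fun v => f v ∈ C v).card := by simp
    _ = ∑ y : X, ∑ v : V, if f v + y ∈ C v then 1 else 0 := Finset.sum_congr rfl fun y _ => h1 y
    _ = ∑ v : V, ∑ y : X, if f v + y ∈ C v then 1 else 0 := Finset.sum_comm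
    _ = ∑ v : V, (C v).card := by
        refine Finset.sum_congr rfl fun v _ => ?_
        calc (∑ y : X, if f v + y ∈ C v then 1 else 0)
            = ∑ y : X, if y ∈ C v then 1 else 0 :=
              Equiv.sum_comp (Equiv.addLeft (f v)) fun y => if y ∈ C v then 1 else 0
          _ = (C v).card := by simp
    _ ≤ ∑ _v : V, K := Finset.sum_le_sum fun v _ => hK v
    _ = K * Fintype.card V := by simp [mul_comm]

/-- Adding `y` to all coordinates from `k` on. -/
def shiftFrom {L : ℕ} {X : Type*} [AddCommGroup X] (k : ℕ) (y : X) : (Fin L → X) ≃ (Fin L → X) where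
  toFun v t := if t.1 < k then v t else v t + y
  invFun v t := if t.1 < k then v t else v t - y
  left_inv v := by funext t; dsimp only; split_ifs <;> simp
  right_inv v := by funext t; dsimp only; split_ifs <;> simp

/-- `F v` depends only on the coordinates of `v` below `k`. -/
def DependsBelow {L : ℕ} {X Y : Type*} (k : ℕ) (F : (Fin L → X) → Y) : Prop :=
  ∀ v w, (∀ t : Fin L, t.1 < k → v t = w t) → F v = F w

theorem DependsBelow.shiftFrom {L : ℕ} {X Y : Type*} [AddCommGroup X] {k : ℕ}
    {F : (Fin L → X) → Y} (hF : DependsBelow k F) (y : X) (v : Fin L → X) :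
    F (shiftFrom k y v) = F v :=
  hF _ _ fun t ht => by simp [_root_.shiftFrom, ht]

theorem card_third_le {m : ℕ} (σ : Fin m → ℝ) (h0 : ∀ b, 0 ≤ σ b) (h1 : ∑ b, σ b = 1) :
    (Finset.univ.filter fun b => 1 / 3 ≤ σ b).card ≤ 3 := by
  have h : ((Finset.univ.filter fun b => 1 / 3 ≤ σ b).card : ℝ) * (1 / 3) ≤ 1 := by
    rw [← h1, ← nsmul_eq_mul]
    exact (Finset.card_nsmul_le_sum _ _ _ fun b hb => (Finset.mem_filter.1 hb).2).trans
      (Finset.sum_le_sum_of_subset_of_nonneg (Finset.subset_univ _) fun b _ _ => h0 b)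
  have : ((Finset.univ.filter fun b => 1 / 3 ≤ σ b).card : ℝ) ≤ 3 := by linarith
  exact_mod_cast this

end Counting

/-! ### One step of a decision tree, and the endpoints its output allows. -/

namespace QueryTree

variable {n m : ℕ}

/-- The first query of a tree, if any. -/
def firstQuery : QueryTree n m → Finset (Fin n → Fin m)
  | .output _ => ∅
  | .query a _ => {a}

/-- The tree that remains when the first query is answered according to `f`. -/
def answer (f : (Fin n → Fin m) → ℝ) : QueryTree n m → QueryTree n m
  | .output σ => .output σ
  | .query a next => next fun _ => f a

/-- The output of a tree that asks no queries, and a default value for other trees. -/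
def out : QueryTree n m → Fin n → Fin m → ℝ
  | .output σ => σ
  | .query _ _ => 0

open Classical in
/-- The profiles all of whose coordinates are substantial for the output of a tree. -/
noncomputable def candidates (τ : QueryTree n m) : Finset (Fin n → Fin m) :=
  if ∀ i, τ.out i ∈ stdSimplex ℝ (Fin m) then
    Fintype.piFinset fun i => Finset.univ.filter fun b => 1 / 3 ≤ τ.out i b
  else ∅

theorem card_candidates_le (τ : QueryTree n m) : τ.candidates.card ≤ 3 ^ n := by
  unfold candidates
  split_ifs with h
  · rw [Fintype.card_piFinset]
    calc _ ≤ ∏ _i : Fin n, 3 := Finset.prod_le_prod' fun i _ => card_third_le _ (h i).1 (h i).2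
      _ = 3 ^ n := by simp
  · simp

end QueryTree

/-! ### Paths through prescribed nodes. -/

section Path

variable {n m L : ℕ} [NeZero m]

/-- The nodes of a path: the profile `0`, followed by the entries of `v`. -/
def node (v : Fin L → Fin n → Fin m) : ℕ → Fin n → Fin m
  | 0 => 0
  | t + 1 => if h : t < L then v ⟨t, h⟩ else 0

/-- The path that moves from each node to the next one by changing the coordinates in order. -/
def pathPoint (v : Fin L → Fin n → Fin m) (s : ℕ) (i : Fin n) : Fin m :=
  if i.1 < s % n then node v (s / n + 1) i else node v (s / n) i

theorem pathPoint_zero (v : Fin L → Fin n → Fin m) : pathPoint v 0 = 0 := by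
  funext i
  simp [pathPoint, node]

theorem pathPoint_last (v : Fin L → Fin n → Fin m) (hL : 0 < L) (i : Fin n) :
    pathPoint v (L * n) i = v ⟨L - 1, by omega⟩ i := by
  have hn : 0 < n := i.pos
  obtain ⟨L, rfl⟩ : ∃ L', L = L' + 1 := ⟨L - 1, by omega⟩
  simp [pathPoint, Nat.mul_div_cancel _ hn, node]

theorem pathPoint_succ (hn : 0 < n) (v : Fin L → Fin n → Fin m) (s : ℕ) :
    ∃ i, ∀ j, j ≠ i → pathPoint v (s + 1) j = pathPoint v s j := by
  refine ⟨⟨s % n, Nat.mod_lt _ hn⟩, fun j hj => ?_⟩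
  have hj' : j.1 ≠ s % n := fun h => hj (Fin.ext h)
  have hlt := Nat.mod_lt s hn
  by_cases h : s % n + 1 = n
  · have hd : s + 1 = n * (s / n + 1) := by
      have := Nat.div_add_mod s n
      rw [mul_add]
      omega
    have h1 : (s + 1) % n = 0 := by rw [hd]; simp
    have h2 : (s + 1) / n = s / n + 1 := by rw [hd]; simp [hn]
    have h3 : j.1 < s % n := by have := j.2; omega
    simp [pathPoint, h1, h2, h3]
  · have hd : s + 1 = (s % n + 1) + n * (s / n) := by have := Nat.mod_add_div s n; omega
    have h0 : s % n + 1 < n := by omega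
    have h1 : (s + 1) % n = s % n + 1 := by
      rw [hd, Nat.add_mul_mod_self_left, Nat.mod_eq_of_lt h0]
    have h2 : (s + 1) / n = s / n := by
      rw [hd, Nat.add_mul_div_left _ _ hn, Nat.div_eq_of_lt h0, zero_add]
    have h3 : j.1 < s % n + 1 ↔ j.1 < s % n := by omega
    simp [pathPoint, h1, h2, h3]

theorem dependsBelow_node {k t : ℕ} (h : t ≤ k) :
    DependsBelow k fun v : Fin L → Fin n → Fin m => node v t := by
  intro v w hvw
  cases t with
  | zero => rfl
  | succ t =>
    by_cases ht : t < L
    · simpa [node, ht] using hvw ⟨t, ht⟩ h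
    · simp [node, ht]

/-- Segment `s / n` borrows coordinates from node `s / n + 1`, which is the entry of `v` with index
`s / n`; hence the strict inequality. -/
theorem dependsBelow_pathPoint {k s : ℕ} (h : s / n < k) :
    DependsBelow k fun v : Fin L → Fin n → Fin m => pathPoint v s := by
  intro v w hvw
  funext i
  have h1 := congrFun (dependsBelow_node (Nat.succ_le_of_lt h) v w hvw) i
  have h2 := congrFun (dependsBelow_node h.le v w hvw) i
  exact if_congr Iff.rfl h1 h2

theorem node_shiftFrom {k t : ℕ} (hk : k < t) (ht : t ≤ L) (y : Fin n → Fin m)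
    (v : Fin L → Fin n → Fin m) : node (shiftFrom k y v) t = node v t + y := by
  cases t with
  | zero => omega
  | succ t =>
    have h1 : t < L := ht
    have h2 : ¬ t < k := by omega
    simp [node, shiftFrom, h1, h2]

/-- Both nodes that supply coordinates have index above `k`, so they move by the same `y`. This
makes points ahead of the current segment uniform. -/
theorem pathPoint_shiftFrom {k s : ℕ} (hk : k < s / n) (hs : s ≤ L * n) (y : Fin n → Fin m)
    (v : Fin L → Fin n → Fin m) : pathPoint (shiftFrom k y v) s = pathPoint v s + y := by
  funext i
  have hn : 0 < n := i.pos
  have h1 : s / n ≤ L := Nat.div_le_of_le_mul (by rwa [mul_comm])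
  simp only [pathPoint, Pi.add_apply]
  split_ifs with h
  -- At `s = L * n` the remainder is 0, so the default node `L + 1` is never used.
  · have h2 : s / n + 1 ≤ L := by
      by_contra hlt
      have h3 : s / n = L := by omega
      have h4 := Nat.div_add_mod s n
      rw [h3, mul_comm] at h4
      omega
    rw [node_shiftFrom (by omega) h2]
    rfl
  · rw [node_shiftFrom hk h1]
    rfl

end Path

/-! ### Induction on the number of queries. -/

section Induction

variable {n m L : ℕ} [NeZero m]

/-- The game in which all utilities are the path potential of the path with nodes `v`. -/
noncomputable def pathGame (G : ℝ) (v : Fin L → Fin n → Fin m) : Game n m :=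
  fun _ => pathPotential (L * n) (fun s => G ^ (s + 1)) (pathPoint v)

theorem isPotentialGame_pathGame (G : ℝ) (v : Fin L → Fin n → Fin m) :
    IsPotentialGame (pathGame G v) :=
  ⟨_, fun _ _ _ _ => rfl⟩

/-- The path potential without the bonuses on the part of the path beyond the node `k + 1`. -/
noncomputable def truncatedPotential (G : ℝ) (k : ℕ) (v : Fin L → Fin n → Fin m)
    (a : Fin n → Fin m) : ℝ :=
  pathPotential (L * n) (fun s => if s / n ≤ k then G ^ (s + 1) else 0) (pathPoint v) a

theorem dependsBelow_truncatedPotential (G : ℝ) (k : ℕ) :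
    DependsBelow (k + 1) fun v : Fin L → Fin n → Fin m => truncatedPotential G k v := by
  intro v w hvw
  funext a
  simp only [truncatedPotential, pathPotential]
  congr 1
  refine Finset.sum_congr rfl fun s _ => ?_
  by_cases h : s / n ≤ k
  · have := dependsBelow_pathPoint (Nat.lt_succ_of_le h) v w hvw
    simp only at this
    rw [this]
  · simp [h]

theorem truncatedPotential_eq (G : ℝ) (k : ℕ) (v : Fin L → Fin n → Fin m) (a : Fin n → Fin m)
    (h : ∀ s ≤ L * n, k < s / n → a ≠ pathPoint v s) (i : Fin n) :
    pathGame G v i a = truncatedPotential G k v a := by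
  simp only [pathGame, truncatedPotential, pathPotential]
  congr 1
  refine Finset.sum_congr rfl fun s hs => ?_
  by_cases hk : s / n ≤ k
  · simp [hk]
  · simp [h s (Nat.lt_succ_iff.1 (Finset.mem_range.1 hs)) (not_le.1 hk)]

/-- The tree solves the path game with nodes `v` with at most `k` queries. -/
def QueryTree.Solves (G : ℝ) (k : ℕ) (v : Fin L → Fin n → Fin m) (τ : QueryTree n m) : Prop :=
  τ.numQueries (pathGame G v) ≤ k ∧ IsNashEquilibrium (pathGame G v) (τ.result (pathGame G v))

open Classical in
/-- A tree that has seen the first `k` nodes and may ask `q` more queries solves few path games: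
every query reveals essentially one more node. -/
theorem card_solves_le (hn : 0 < n) {G : ℝ} (hG : 300 * (((L * n : ℕ) : ℝ) + 1) ≤ G)
    (hGn : (2 : ℝ) ^ n ≤ G) (q k : ℕ) (hkq : k + q < L)
    (τ : (Fin L → Fin n → Fin m) → QueryTree n m) (hτ : DependsBelow k τ) :
    Fintype.card (Fin n → Fin m) * (Finset.univ.filter fun v => (τ v).Solves G q v).card ≤
      (q * (L * n + 1) + 3 ^ n) * Fintype.card (Fin L → Fin n → Fin m) := by
  induction q generalizing k τ with
  | zero =>
    have hL : 0 < L := by omega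
    have hsub : (Finset.univ.filter fun v => (τ v).Solves G 0 v) ⊆
        Finset.univ.filter fun v => v ⟨L - 1, by omega⟩ ∈ (τ v).candidates := by
      intro v hv
      simp only [Finset.mem_filter, Finset.mem_univ, true_and] at hv ⊢
      obtain ⟨hv1, hv2⟩ := hv
      cases hτv : τ v with
      | query a next => simp [hτv, QueryTree.numQueries] at hv1
      | output σ =>
        simp only [hτv, QueryTree.result] at hv2
        have h1 : ∀ i, (QueryTree.output σ : QueryTree n m).out i ∈ stdSimplex ℝ (Fin m) := hv2.1
        rw [QueryTree.candidates, if_pos h1, Fintype.mem_piFinset]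
        intro i
        have h2 := hv2.one_third_le (Nat.mul_pos hL hn) hG hGn (pathPoint_zero v)
          (fun s _ => pathPoint_succ hn v s) i
        rw [pathPoint_last v hL i] at h2
        simpa [QueryTree.out] using h2
    refine (Nat.mul_le_mul_left _ (Finset.card_le_card hsub)).trans ?_
    rw [zero_mul, zero_add]
    refine card_mul_card_filter_mem_le (shiftFrom k) (fun v => v ⟨L - 1, by omega⟩)
      (fun y v => ?_) _ (fun y v => ?_) fun v => (τ v).card_candidates_le
    -- `k + q < L` keeps the last node unseen.
    · have : ¬ L - 1 < k := by omega
      simp [shiftFrom, this]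
    · rw [hτ.shiftFrom]
  | succ q ih =>
    -- The answer is absorbed into the dependence of the tree on `v`, at the price of one more node.
    set τ' : (Fin L → Fin n → Fin m) → QueryTree n m :=
      fun v => (τ v).answer (truncatedPotential G k v) with hτ'
    have hdep : DependsBelow (k + 1) τ' := by
      intro v w hvw
      have h1 := hτ v w fun t ht => hvw t (by omega)
      have h2 := dependsBelow_truncatedPotential G k v w hvw
      simp only at h2
      simp only [hτ', h1, h2]
    have hsub : (Finset.univ.filter fun v => (τ v).Solves G (q + 1) v) ⊆
        (Finset.univ.filter fun v => (τ' v).Solves G q v) ∪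
          ((Finset.range (L * n + 1)).filter fun s => k < s / n).biUnion fun s =>
            Finset.univ.filter fun v => pathPoint v s ∈ (τ v).firstQuery := by
      intro v hv
      simp only [Finset.mem_filter, Finset.mem_univ, true_and, Finset.mem_union,
        Finset.mem_biUnion, Finset.mem_range] at hv ⊢
      by_contra! hcon
      obtain ⟨h1, h2⟩ := hcon
      refine h1 ?_
      obtain ⟨hv1, hv2⟩ := hv
      cases hτv : τ v with
      | output σ =>
        simp only [hτv, QueryTree.result] at hv2
        simp only [hτ', hτv, QueryTree.answer]
        exact ⟨Nat.zero_le _, hv2⟩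
      | query a next =>
        have h3 : ∀ i, pathGame G v i a = truncatedPotential G k v a := by
          refine truncatedPotential_eq G k v a fun s hs hks has => ?_
          exact h2 s ⟨Nat.lt_succ_of_le hs, hks⟩ (by simp [hτv, QueryTree.firstQuery, has])
        simp only [hτv, QueryTree.result, QueryTree.numQueries, h3] at hv1 hv2
        simp only [hτ', hτv, QueryTree.answer]
        exact ⟨by omega, hv2⟩
    have hbad : ∀ s ∈ (Finset.range (L * n + 1)).filter fun s => k < s / n,
        Fintype.card (Fin n → Fin m) *
          (Finset.univ.filter fun v => pathPoint v s ∈ (τ v).firstQuery).card ≤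
            Fintype.card (Fin L → Fin n → Fin m) := by
      intro s hs
      simp only [Finset.mem_filter, Finset.mem_range] at hs
      have := card_mul_card_filter_mem_le (shiftFrom k)
        (fun v : Fin L → Fin n → Fin m => pathPoint v s)
        (fun y v => pathPoint_shiftFrom hs.2 (by omega) y v) (fun v => (τ v).firstQuery)
        (fun y v => by rw [hτ.shiftFrom]) (K := 1) fun v => by
          cases τ v <;> simp [QueryTree.firstQuery]
      simpa using this
    have hcard := (Finset.card_le_card hsub).trans (Finset.card_union_le _ _)
    have hcard2 := Finset.card_biUnion_le
      (s := (Finset.range (L * n + 1)).filter fun s => k < s / n)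
      (t := fun s => Finset.univ.filter fun v => pathPoint v s ∈ (τ v).firstQuery)
    have hsum := Finset.sum_le_sum hbad
    rw [← Finset.mul_sum, Finset.sum_const, smul_eq_mul] at hsum
    have hle : ((Finset.range (L * n + 1)).filter fun s => k < s / n).card ≤ L * n + 1 :=
      (Finset.card_filter_le _ _).trans_eq (Finset.card_range _)
    refine (Nat.mul_le_mul_left _ (hcard.trans (Nat.add_le_add_left hcard2 _))).trans ?_
    rw [mul_add]
    refine (Nat.add_le_add (ih (k + 1) (by omega) τ' hdep)
      (hsum.trans (Nat.mul_le_mul_right _ hle))).trans_eq ?_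
    ring

end Induction

/-! ### Averaging over paths and coins. -/

open Classical in
/-- Fewer than `2 ^ n` queries do not suffice. -/
theorem two_pow_le_of_nashSolvableWithin {n k : ℕ} (hn : 0 < n) (h : NashSolvableWithin n 30 k) :
    2 ^ n ≤ k := by
  by_contra! hk
  obtain ⟨Ω, _, P, _, T, hT⟩ := h
  set V := Fin (2 ^ n) → Fin n → Fin 30
  set G : ℝ := 300 * (((2 ^ n * n : ℕ) : ℝ) + 1) with hG
  have hGn : (2 : ℝ) ^ n ≤ G := by
    have h1 : (1 : ℝ) ≤ n := by exact_mod_cast hn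
    have h2 : (0 : ℝ) < 2 ^ n := by positivity
    rw [hG]
    push_cast
    nlinarith
  set E : V → Set Ω := fun v => {ω | IsNashEquilibrium (pathGame G v) ((T ω).result (pathGame G v))}
  have hE1 : ∀ v, MeasurableSet (E v) := fun v => (hT _ (isPotentialGame_pathGame G v)).2.1
  have hE2 : ∀ v, 2 / 3 ≤ P (E v) := fun v => (hT _ (isPotentialGame_pathGame G v)).2.2
  have hV : 0 < Fintype.card V := Fintype.card_pos
  have hpt : ∀ ω, (∑ v, (E v).indicator (1 : Ω → ℝ≥0∞) ω) ≤ (Fintype.card V : ℝ≥0∞) * (1 / 2) := by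
    intro ω
    have h1 := card_solves_le hn (m := 30) hG.le hGn k 0 (by omega) (fun _ : V => T ω)
      fun _ _ _ => rfl
    have h2 : ∑ v, (E v).indicator (1 : Ω → ℝ≥0∞) ω =
        ((Finset.univ.filter fun v : V => (T ω).Solves G k v).card : ℝ≥0∞) := by
      rw [Finset.card_filter]
      push_cast
      refine Finset.sum_congr rfl fun v _ => ?_
      have h3 : ω ∈ E v ↔ (T ω).Solves G k v :=
        ⟨fun h => ⟨(hT _ (isPotentialGame_pathGame G v)).1 ω, h⟩, fun h => h.2⟩
      simp [Set.indicator_apply, h3]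
    set N := (Finset.univ.filter fun v : V => (T ω).Solves G k v).card
    have h3 : 2 * N ≤ Fintype.card V := by
      have h4 : Fintype.card (Fin n → Fin 30) = 30 ^ n := by simp
      have h5 : n + 1 ≤ 2 ^ n := Nat.lt_two_pow_self
      have h6 : k * (2 ^ n * n + 1) ≤ 8 ^ n := by
        calc k * (2 ^ n * n + 1) ≤ 2 ^ n * (2 ^ n * (n + 1)) := by
              refine Nat.mul_le_mul hk.le ?_
              rw [mul_add, mul_one]
              exact Nat.add_le_add_left Nat.one_le_two_pow _
          _ ≤ 2 ^ n * (2 ^ n * 2 ^ n) := by gcongr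
          _ = 8 ^ n := by rw [← mul_pow, ← mul_pow]; norm_num
      -- `8 ^ n` bounds queries times path points, `3 ^ n` the compatible endpoints; 30 actions
      -- leave ample room.
      have h7 : 2 * (8 ^ n + 3 ^ n) ≤ 30 ^ n := by
        obtain ⟨n, rfl⟩ : ∃ n', n = n' + 1 := ⟨n - 1, by omega⟩
        have h8 : 8 ^ n ≤ 30 ^ n := Nat.pow_le_pow_left (by norm_num) n
        have h9 : 3 ^ n ≤ 30 ^ n := Nat.pow_le_pow_left (by norm_num) n
        rw [pow_succ, pow_succ, pow_succ]
        omega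
      rw [h4] at h1
      have h10 : 30 ^ n * (2 * N) ≤ 30 ^ n * Fintype.card V := by
        calc 30 ^ n * (2 * N) = 2 * (30 ^ n * N) := by ring
          _ ≤ 2 * ((k * (2 ^ n * n + 1) + 3 ^ n) * Fintype.card V) := Nat.mul_le_mul_left _ h1
          _ ≤ 2 * ((8 ^ n + 3 ^ n) * Fintype.card V) := by gcongr
          _ = 2 * (8 ^ n + 3 ^ n) * Fintype.card V := by ring
          _ ≤ _ := Nat.mul_le_mul_right _ h7
      exact Nat.le_of_mul_le_mul_left h10 (by positivity)
    rw [h2, mul_one_div, ENNReal.le_div_iff_mul_le (by simp) (by simp), mul_comm]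
    exact_mod_cast h3
  have h1 : (Fintype.card V : ℝ≥0∞) * (2 / 3) ≤ (Fintype.card V : ℝ≥0∞) * (1 / 2) := by
    calc (Fintype.card V : ℝ≥0∞) * (2 / 3) = ∑ _v : V, (2 / 3 : ℝ≥0∞) := by simp
      _ ≤ ∑ v, P (E v) := Finset.sum_le_sum fun v _ => hE2 v
      _ = ∑ v, ∫⁻ ω, (E v).indicator 1 ω ∂P :=
        Finset.sum_congr rfl fun v _ => (lintegral_indicator_one (hE1 v)).symm
      _ = ∫⁻ ω, ∑ v, (E v).indicator 1 ω ∂P :=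
        (lintegral_finsetSum _ fun v _ => measurable_one.indicator (hE1 v)).symm
      _ ≤ ∫⁻ _, (Fintype.card V : ℝ≥0∞) * (1 / 2) ∂P := lintegral_mono hpt
      _ = _ := by simp
  have h2 : (2 / 3 : ℝ≥0∞) ≤ 1 / 2 :=
    (ENNReal.mul_le_mul_iff_right (by exact_mod_cast hV.ne') (by simp)).1 h1
  have h3 := ENNReal.toReal_mono (by simp) h2
  norm_num at h3

theorem corollary4p5 :
    ∃ c : ℝ, 0 < c ∧ ∀ᶠ n : ℕ in atTop,
      ENNReal.ofReal ((2 : ℝ) ^ (c * (n : ℝ))) ≤ (nashQueryComplexity n 30 : ℝ≥0∞) := by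
  refine ⟨1, one_pos, (eventually_gt_atTop 0).mono fun n hn => ?_⟩
  have h1 : ENNReal.ofReal ((2 : ℝ) ^ ((1 : ℝ) * (n : ℝ))) = (((2 ^ n : ℕ) : ℕ∞) : ℝ≥0∞) := by
    rw [one_mul, Real.rpow_natCast, ENNReal.ofReal_pow (by norm_num)]
    simp
  rw [h1, ENat.toENNReal_le]
  exact le_iInf₂ fun k hk => by exact_mod_cast two_pow_le_of_nashSolvableWithin hn hk
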